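/- Let $k$ be an infinite field (for instance an algebraically closed field) and let $\alpha:\Gamma\hookrightarrow\mathbb P^2_k$ be the closed embedding of a $(3,3)$-complete intersection, i.e. $\Gamma$ is a finite $k$-scheme and the homogeneous ideal of $\alpha(\Gamma)$ is generated by two cubic forms without common factor; $\Gamma$ may be any such scheme, in particular the nine points of a general one. Recall that if $W\subset H^0(\Gamma,L)$, with $L=\alpha^*\mathcal O(1)$, is the space spanned by the homogeneous coordinates of $\alpha$ and $K_\Gamma$ is the dualizing module, the Gale transform of $\alpha$ is the map to projective space given by a basis of the annihilator $W^\perp\subset H^0(\Gamma,K_\Gamma\otimes L^\vee)\cong H^0(\Gamma,L)^\vee$; it is determined up to a projective change of coordinates of the target. (Existence) $\Gamma$ is Gorenstein, $\alpha$ has a Gale transform $\beta$ with target $\mathbb P^5$, $\beta$ is a morphism, and for every choice of coordinates of $\mathbb P^5$ it factors as $\beta=\pi\circ\alpha$, where $\pi:\mathbb P^2\to\mathbb P^5$ is a Veronese map, i.e. given by a basis of $H^0(\mathbb P^2,\mathcal O(2))$. (Uniqueness) This factorization is unique up to reparametrization of $\mathbb P^2$: if $\alpha':\Gamma\to\mathbb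 P^2$ is a closed embedding of the same $\Gamma$ as a $(3,3)$-complete intersection and $\pi':\mathbb P^2\to\mathbb P^5$ is a Veronese map with $\beta=\pi'\circ\alpha'$, then there is an automorphism $\kappa$ of $\mathbb P^2$ with $\alpha'=\kappa\circ\alpha$ and $\pi=\pi'\circ\kappa$. -/

import Mathlib

/-!
Throughout, `k` is a field and `Γ = Spec A` is a finite `k`-scheme, i.e. `A` is a `k`-algebra of
finite dimension.  Every line bundle on `Γ` is trivial, so a morphism `Γ ⟶ ℙⁿ` is the same as a
tuple of `n + 1` elements of `A` generating the unit ideal, taken up to multiplication by a unit of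
`A`.  (For `A = k × ⋯ × k` this is a finite sequence of `k`-points of `ℙⁿ`.)
-/

namespace GoppaVeronese

open MvPolynomial

section Points

variable {A : Type*} [CommRing A] {ι : Type*}

/-- The homogeneous coordinates `v` define a morphism from `Spec A` to projective space
(they have no common zero on `Spec A`). -/
def IsProjPoint (v : ι → A) : Prop :=
  Ideal.span (Set.range v) = ⊤

/-- Two tuples of homogeneous coordinates define the same morphism from `Spec A` to projective
space: they differ by a unit of `A`. -/
def SameProjPoint (v w : ι → A) : Prop :=
  ∃ u : Aˣ, ∀ i, w i = (u : A) * v i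

end Points

section Embeddings

variable (k : Type*) [Field k] {A : Type*} [CommRing A] [Algebra k A]

/-- The morphism `Spec A ⟶ ℙⁿ` with homogeneous coordinates `a` is a closed embedding
(`A` finite over `k`): for some (equivalently, every large) `d`, restriction of forms of degree `d`
to `Spec A` is surjective. -/
def IsClosedEmbedding {ι : Type*} (a : ι → A) : Prop :=
  IsProjPoint a ∧
    ∃ d : ℕ, ∀ x : A, ∃ P : MvPolynomial ι k, P.IsHomogeneous d ∧ aeval a P = x

/-- The morphism `Spec A ⟶ ℙ²` with homogeneous coordinates `a` is the closed embedding of a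
`(d₁, d₂)`-complete intersection: it is a closed embedding, and the homogeneous ideal of its image
is generated by two forms of degrees `d₁`, `d₂` without common factor. -/
def IsCompleteIntersection (d₁ d₂ : ℕ) (a : Fin 3 → A) : Prop :=
  IsClosedEmbedding k a ∧
    ∃ F G : MvPolynomial (Fin 3) k,
      F.IsHomogeneous d₁ ∧ G.IsHomogeneous d₂ ∧ IsRelPrime F G ∧
      ∀ (d : ℕ) (P : MvPolynomial (Fin 3) k), P.IsHomogeneous d →
        (aeval a P = 0 ↔ P ∈ Ideal.span {F, G})

/-- The functional `φ` on `A` generates the dualizing module `K_Γ = Hom_k(A, k)` as an `A`-module;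
equivalently, the pairing `(x, y) ↦ φ (x y)` is perfect.  Such a `φ` exists iff the finite scheme
`Γ = Spec A` is Gorenstein, and it amounts to an isomorphism `A ≅ K_Γ`. -/
def IsDualizingGenerator (φ : A →ₗ[k] k) : Prop :=
  ∀ ψ : A →ₗ[k] k, ∃ x : A, ∀ y : A, ψ y = φ (x * y)

/-- `b` gives homogeneous coordinates for the Gale transform of the map `Spec A ⟶ ℙʳ` with
homogeneous coordinates `a`.  The coordinates `a` are a basis of the linear series
`W ⊆ H⁰(Γ, L) = A`.  For a generator `φ` of `K_Γ`, the duality pairing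
`H⁰(Γ, L) × H⁰(Γ, K_Γ ⊗ L^∨) → k` becomes `(x, y) ↦ φ (x y)` on `A × A`, and `b` is a basis of the
annihilator `W^⊥` of `W`.  (Another `φ` multiplies `W^⊥` by a unit of `A`; another basis of `W^⊥`
changes the map by an automorphism of the target projective space.) -/
def IsGaleTransform {ι κ : Type*} (a : ι → A) (b : κ → A) : Prop :=
  LinearIndependent k a ∧ LinearIndependent k b ∧
    ∃ φ : A →ₗ[k] k, IsDualizingGenerator k φ ∧
      ∀ y : A, y ∈ Submodule.span k (Set.range b) ↔ ∀ i, φ (a i * y) = 0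

end Embeddings

section Veronese

variable {k : Type*} [Field k]

/-- `q` consists of homogeneous coordinates of a Veronese map `ℙ² ⟶ ℙ⁵`, the map given by a basis
of the complete linear series `H⁰(ℙ², 𝒪(2))`. -/
def IsVeroneseMap (q : Fin 6 → MvPolynomial (Fin 3) k) : Prop :=
  LinearIndependent k q ∧ Submodule.span k (Set.range q) = homogeneousSubmodule (Fin 3) k 2

/-- Two tuples of forms of the same degree define the same map from `ℙ²`: they differ by a nonzero
constant. -/
def SameMap {ι : Type*} (p q : ι → MvPolynomial (Fin 3) k) : Prop :=
  ∃ c : k, c ≠ 0 ∧ ∀ i, q i = C c * p i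

/-- The forms `∑ j, κ i j X j` defining the automorphism of `ℙ²` given by the invertible
matrix `κ`. -/
noncomputable def linearForms (κ : GL (Fin 3) k) (i : Fin 3) : MvPolynomial (Fin 3) k :=
  ∑ j, C ((κ : Matrix (Fin 3) (Fin 3) k) i j) * X j

/-- The composite `q ∘ p` of two maps given by tuples of forms, where `p` goes from `ℙ²` to
`ℙ²`. -/
noncomputable def compMap {ι : Type*} (q : ι → MvPolynomial (Fin 3) k)
    (p : Fin 3 → MvPolynomial (Fin 3) k) : ι → MvPolynomial (Fin 3) k :=
  fun i => bind₁ p (q i)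

/-- The composite of a morphism `Spec A ⟶ ℙ²` with a map from `ℙ²` given by a tuple of forms. -/
noncomputable def compPoint {A : Type*} [CommRing A] [Algebra k A] {ι : Type*}
    (q : ι → MvPolynomial (Fin 3) k) (a : Fin 3 → A) : ι → A :=
  fun i => aeval a (q i)

end Veronese

end GoppaVeronese

/-! Since `k` is infinite, some line ℓ = 0 misses Γ. Dividing the coordinates by the value of ℓ
makes that value 1, so the spaces V_d of values of forms of degree d (`formValues`) increase with d.
By `aeval_mem_formValues_iff`, V_{d+1}/V_d is the part of degree d+1 of k[s,t]/(f,g), where f, g are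
the two cubics restricted to the line. The Koszul syzygy shows that this ring has socle only in
degree 4, of dimension at most one (`mem_span_pair_of_X_mul_mem`, `exists_linear_relation`). Hence
V_4 = A, V_3 is a hyperplane, and a functional φ with kernel V_3 generates the dualizing module,
with V_i and V_{3-i} mutual annihilators for φ(xy)
(`IsCompleteIntersection.exists_dualizingGenerator`).

For i = 1, the annihilator of the lines is the space of conics. No conic vanishes on Γ, so a basis
of this annihilator is a Veronese map composed with the embedding.

For uniqueness, duality recovers V_1 from V_2 up to a unit (`exists_unit_formValues_one`), which
produces κ. The two Veronese maps then differ by a multiplier preserving V_2, hence V_1, and such a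
multiplier is constant (`IsCompleteIntersection.exists_eq_algebraMap`). -/

namespace GoppaVeronese

open MvPolynomial

/-! ### Homogeneous components and ideals generated by two forms. -/

section Forms

variable {k : Type*} [Field k] {σ : Type*}

theorem homogeneousComponent_mul_of_isHomogeneous {q : MvPolynomial σ k} {e : ℕ}
    (hq : q.IsHomogeneous e) (p : MvPolynomial σ k) (d : ℕ) :
    homogeneousComponent (d + e) (p * q) = homogeneousComponent d p * q := by
  let _ := gradedAlgebra (σ := σ) (R := k)
  have h := DirectSum.coe_decompose_mul_of_right_mem_of_le (homogeneousSubmodule σ k)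
    (a := p) (b := q) (i := e) (n := d + e) hq (by omega)
  rw [Nat.add_sub_cancel] at h
  exact (decomposition.decompose'_apply _ _).symm.trans
    (h.trans (congrArg (· * q) (decomposition.decompose'_apply _ _)))

theorem homogeneousComponent_mul_of_lt {q : MvPolynomial σ k} {e : ℕ}
    (hq : q.IsHomogeneous e) (p : MvPolynomial σ k) {d : ℕ} (hd : d < e) :
    homogeneousComponent d (p * q) = 0 := by
  let _ := gradedAlgebra (σ := σ) (R := k)
  have h := DirectSum.coe_decompose_mul_of_right_mem_of_not_le (homogeneousSubmodule σ k)
    (a := p) (b := q) (i := e) (n := d) hq (by omega)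
  exact (decomposition.decompose'_apply _ _).symm.trans h

theorem dvd_homogeneousComponent_mul {q : MvPolynomial σ k} {e : ℕ} (hq : q.IsHomogeneous e)
    (p : MvPolynomial σ k) (d : ℕ) : q ∣ homogeneousComponent d (p * q) := by
  rcases lt_or_ge d e with hd | hd
  · rw [homogeneousComponent_mul_of_lt hq _ hd]
    exact dvd_zero _
  · obtain ⟨n, rfl⟩ := Nat.exists_eq_add_of_le' hd
    rw [homogeneousComponent_mul_of_isHomogeneous hq]
    exact dvd_mul_left _ _

theorem isHomogeneous_X_mul {p : MvPolynomial σ k} {d : ℕ} (hp : p.IsHomogeneous d) (i : σ) :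
    (X i * p).IsHomogeneous (d + 1) :=
  add_comm 1 d ▸ (isHomogeneous_X k i).mul hp

theorem eq_zero_of_eq_mul_of_lt {p w q : MvPolynomial σ k} {d e : ℕ} (hp : p.IsHomogeneous d)
    (hq : q.IsHomogeneous e) (h : p = w * q) (hd : d < e) : p = 0 := by
  rw [← homogeneousComponent_eq_self hp, h, homogeneousComponent_mul_of_lt hq _ hd]

theorem exists_isHomogeneous_of_eq_mul {p w q : MvPolynomial σ k} {d e : ℕ}
    (hp : p.IsHomogeneous (d + e)) (hq : q.IsHomogeneous e) (h : p = w * q) :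
    ∃ w' : MvPolynomial σ k, w'.IsHomogeneous d ∧ p = w' * q :=
  ⟨_, homogeneousComponent_isHomogeneous d w, by
    rw [← homogeneousComponent_mul_of_isHomogeneous hq, ← h, homogeneousComponent_eq_self hp]⟩

theorem eq_zero_of_mem_span_pair_of_lt {p f g : MvPolynomial σ k} {d e : ℕ}
    (hp : p.IsHomogeneous d) (hf : f.IsHomogeneous e) (hg : g.IsHomogeneous e)
    (h : p ∈ Ideal.span {f, g}) (hd : d < e) : p = 0 := by
  obtain ⟨u, v, rfl⟩ := Ideal.mem_span_pair.1 h
  rw [← homogeneousComponent_eq_self hp, map_add, homogeneousComponent_mul_of_lt hf _ hd,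
    homogeneousComponent_mul_of_lt hg _ hd, add_zero]

theorem exists_isHomogeneous_of_mem_span_pair {p f g : MvPolynomial σ k} {d e : ℕ}
    (hp : p.IsHomogeneous (d + e)) (hf : f.IsHomogeneous e) (hg : g.IsHomogeneous e)
    (h : p ∈ Ideal.span {f, g}) :
    ∃ u v : MvPolynomial σ k, u.IsHomogeneous d ∧ v.IsHomogeneous d ∧ p = u * f + v * g := by
  obtain ⟨u, v, rfl⟩ := Ideal.mem_span_pair.1 h
  refine ⟨_, _, homogeneousComponent_isHomogeneous d u, homogeneousComponent_isHomogeneous d v, ?_⟩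
  rw [← homogeneousComponent_mul_of_isHomogeneous hf, ← homogeneousComponent_mul_of_isHomogeneous hg,
    ← map_add, homogeneousComponent_eq_self hp]

end Forms

/-! ### The socle of k[s,t] modulo two coprime cubics. -/

section BinaryForms

variable {k : Type*} [Field k]

theorem X_ne_mul_X {σ : Type*} {i j : σ} (hij : i ≠ j) : ¬ (X i : MvPolynomial σ k) ∣ X j := by
  rw [X_dvd_X]
  simpa using hij

theorem exists_of_X_mul_eq_X_mul {σ : Type*} {i j : σ} (hij : i ≠ j) {a b : MvPolynomial σ k}
    (h : X j * a = X i * b) : ∃ c, a = X i * c ∧ b = X j * c := by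
  have h1 : (X i : MvPolynomial σ k) ∣ X j * a := ⟨b, h⟩
  obtain ⟨c, rfl⟩ := (X_prime.dvd_or_dvd h1).resolve_left (X_ne_mul_X hij)
  refine ⟨c, rfl, mul_left_cancel₀ (X_ne_zero i) ?_⟩
  rw [← h]; ring

variable {f g : MvPolynomial (Fin 2) k}

/-- Replacing (u, v) by (u - w₁ g, v + w₁ f) leaves u f + v g unchanged and makes both cofactors
divisible by `X 0`, which can then be cancelled. -/
theorem mem_span_pair_of_syzygy {h u v u' v' w w₀ w₁ : MvPolynomial (Fin 2) k}
    (hs : X 0 * h = u * f + v * g)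
    (hw : X 1 * u - X 0 * u' = w * g) (hw' : X 0 * v' - X 1 * v = w * f)
    (h01 : w = X 0 * w₀ + X 1 * w₁) : h ∈ Ideal.span {f, g} := by
  obtain ⟨p, hp, -⟩ := exists_of_X_mul_eq_X_mul (k := k) (i := (0 : Fin 2)) (j := 1) (by decide)
    (a := u - w₁ * g) (b := u' + w₀ * g) (by linear_combination hw + g * h01)
  obtain ⟨q, hq, -⟩ := exists_of_X_mul_eq_X_mul (k := k) (i := (0 : Fin 2)) (j := 1) (by decide)
    (a := v + w₁ * f) (b := v' - w₀ * f) (by linear_combination - hw' - f * h01)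
  refine Ideal.mem_span_pair.2 ⟨p, q, mul_left_cancel₀ (X_ne_zero (0 : Fin 2)) ?_⟩
  linear_combination - hs - f * hp - g * hq

/-- Expressing `X 0 * h` and `X 1 * h` through f, g and cross-multiplying yields a syzygy of (f, g).
By coprimality it is a Koszul multiple w, of degree deg h - 4; this is the obstruction to h lying in
the ideal. -/
theorem exists_syzygy (hf : f.IsHomogeneous 3) (hg : g.IsHomogeneous 3) (hfg : IsRelPrime f g)
    (hg0 : g ≠ 0) {n : ℕ} {h : MvPolynomial (Fin 2) k} (hh : h.IsHomogeneous (n + 2))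
    (h0 : X 0 * h ∈ Ideal.span {f, g}) (h1 : X 1 * h ∈ Ideal.span {f, g}) :
    ∃ u v u' v' w : MvPolynomial (Fin 2) k, X 0 * h = u * f + v * g ∧
      X 1 * u - X 0 * u' = w * g ∧ X 0 * v' - X 1 * v = w * f ∧
      (n < 2 → w = 0) ∧ ∀ m, n = m + 2 → w.IsHomogeneous m := by
  have hd : ∀ i : Fin 2, (X i * h).IsHomogeneous (n + 3) := isHomogeneous_X_mul hh
  obtain ⟨u, v, hu, hv, huv⟩ := exists_isHomogeneous_of_mem_span_pair (hd 0) hf hg h0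
  obtain ⟨u', v', hu', hv', huv'⟩ := exists_isHomogeneous_of_mem_span_pair (hd 1) hf hg h1
  have key : (X 1 * u - X 0 * u') * f = (X 0 * v' - X 1 * v) * g := by
    linear_combination X 0 * huv' - X 1 * huv
  obtain ⟨w, hw⟩ : g ∣ X 1 * u - X 0 * u' :=
    hfg.symm.dvd_of_dvd_mul_right ⟨X 0 * v' - X 1 * v, by rw [key, mul_comm]⟩
  rw [mul_comm g] at hw
  have hdeg : (X 1 * u - X 0 * u').IsHomogeneous (n + 1) :=
    (isHomogeneous_X_mul hu _).sub (isHomogeneous_X_mul hu' _)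
  have aux : ∀ w, X 1 * u - X 0 * u' = w * g → X 0 * v' - X 1 * v = w * f := fun w hw => by
    refine mul_right_cancel₀ hg0 ?_
    linear_combination - key + f * hw
  rcases lt_or_ge n 2 with hn | hn
  · have h0 := eq_zero_of_eq_mul_of_lt hdeg hg hw (by omega)
    have h0' : X 1 * u - X 0 * u' = 0 * g := by rw [h0, zero_mul]
    exact ⟨u, v, u', v', 0, huv, h0', aux _ h0', fun _ => rfl, fun m hm => isHomogeneous_zero _ _ _⟩
  · obtain ⟨m, rfl⟩ := Nat.exists_eq_add_of_le' hn
    obtain ⟨w', hw'h, hw'⟩ := exists_isHomogeneous_of_eq_mul (d := m) (e := 3) hdeg hg hw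
    refine ⟨u, v, u', v', w', huv, hw', aux _ hw', fun h => by omega, fun m' hm => ?_⟩
    obtain rfl : m = m' := by omega
    exact hw'h

theorem exists_eq_X_mul_add_X_mul {w : MvPolynomial (Fin 2) k} (hw : coeff 0 w = 0) :
    ∃ w₀ w₁, w = X 0 * w₀ + X 1 * w₁ := by
  suffices h : ∀ w : MvPolynomial (Fin 2) k, ∃ w₀ w₁, w = C (coeff 0 w) + X 0 * w₀ + X 1 * w₁ by
    obtain ⟨w₀, w₁, h⟩ := h w
    exact ⟨w₀, w₁, by rwa [hw, C_0, zero_add] at h⟩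
  intro w
  induction w using MvPolynomial.induction_on with
  | C c => exact ⟨0, 0, by simp⟩
  | add p q hp hq =>
    obtain ⟨p₀, p₁, hp⟩ := hp
    obtain ⟨q₀, q₁, hq⟩ := hq
    refine ⟨p₀ + q₀, p₁ + q₁, ?_⟩
    rw [coeff_add, C_add]
    linear_combination hp + hq
  | mul_X p i _ =>
    have h0 : coeff 0 (p * X i) = 0 := by simp [← constantCoeff_eq]
    fin_cases i
    · exact ⟨p, 0, by rw [h0]; simp [mul_comm]⟩
    · exact ⟨0, p, by rw [h0]; simp [mul_comm]⟩

/-- The quotient of `k[s, t]` by two coprime cubic forms has no socle in degrees other than `4`. -/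
theorem mem_span_pair_of_X_mul_mem (hf : f.IsHomogeneous 3) (hg : g.IsHomogeneous 3)
    (hfg : IsRelPrime f g) (hg0 : g ≠ 0) {j : ℕ} (hj : j ≠ 4) {h : MvPolynomial (Fin 2) k}
    (hh : h.IsHomogeneous j) (hX : ∀ i, X i * h ∈ Ideal.span {f, g}) :
    h ∈ Ideal.span {f, g} := by
  rcases lt_or_ge j 2 with hj2 | hj2
  · have h0 := eq_zero_of_mem_span_pair_of_lt ((isHomogeneous_X k 0).mul hh) hf hg (hX 0) (by omega)
    rw [(mul_eq_zero.1 h0).resolve_left (X_ne_zero 0)]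
    exact zero_mem _
  obtain ⟨n, rfl⟩ := Nat.exists_eq_add_of_le' hj2
  obtain ⟨u, v, u', v', w, h1, h2, h3, h4, h5⟩ := exists_syzygy hf hg hfg hg0 hh (hX 0) (hX 1)
  rcases lt_or_ge n 2 with hn | hn
  · exact mem_span_pair_of_syzygy (w₀ := 0) (w₁ := 0) h1 h2 h3 (by simp [h4 hn])
  · obtain ⟨m, rfl⟩ := Nat.exists_eq_add_of_le' hn
    -- As the degree of h is not 4, w has positive degree and so no constant term.
    obtain ⟨w₀, w₁, h01⟩ := exists_eq_X_mul_add_X_mul (w := w)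
      ((h5 m rfl).coeff_eq_zero (d := 0) (by simp; omega))
    exact mem_span_pair_of_syzygy h1 h2 h3 h01

/-- The socle in degree `4` is at most one-dimensional. -/
theorem exists_linear_relation (hf : f.IsHomogeneous 3) (hg : g.IsHomogeneous 3)
    (hfg : IsRelPrime f g) (hg0 : g ≠ 0) {h₁ h₂ : MvPolynomial (Fin 2) k}
    (hh₁ : h₁.IsHomogeneous 4) (hh₂ : h₂.IsHomogeneous 4)
    (hX₁ : ∀ i, X i * h₁ ∈ Ideal.span {f, g}) (hX₂ : ∀ i, X i * h₂ ∈ Ideal.span {f, g}) :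
    ∃ c₁ c₂ : k, (c₁ ≠ 0 ∨ c₂ ≠ 0) ∧ C c₁ * h₁ + C c₂ * h₂ ∈ Ideal.span {f, g} := by
  obtain ⟨u₁, v₁, u₁', v₁', w₁, h1, h2, h3, -, h4⟩ :=
    exists_syzygy (n := 2) hf hg hfg hg0 hh₁ (hX₁ 0) (hX₁ 1)
  obtain ⟨u₂, v₂, u₂', v₂', w₂, h1', h2', h3', -, h4'⟩ :=
    exists_syzygy (n := 2) hf hg hfg hg0 hh₂ (hX₂ 0) (hX₂ 1)
  -- In degree 4 the obstructions w₁, w₂ are constants, so some nontrivial combination of them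
  -- vanishes.
  have hw₁ := homogeneousComponent_eq_self (h4 0 rfl)
  have hw₂ := homogeneousComponent_eq_self (h4' 0 rfl)
  rw [homogeneousComponent_zero] at hw₁ hw₂
  have key : ∀ c₁ c₂ : k, C c₁ * w₁ + C c₂ * w₂ = 0 →
      C c₁ * h₁ + C c₂ * h₂ ∈ Ideal.span {f, g} := fun c₁ c₂ hc => by
    refine mem_span_pair_of_syzygy (u := C c₁ * u₁ + C c₂ * u₂) (v := C c₁ * v₁ + C c₂ * v₂)
      (u' := C c₁ * u₁' + C c₂ * u₂') (v' := C c₁ * v₁' + C c₂ * v₂') (w := 0) (w₀ := 0) (w₁ := 0)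
      ?_ ?_ ?_ (by simp)
    · linear_combination C c₁ * h1 + C c₂ * h1'
    · linear_combination C c₁ * h2 + C c₂ * h2' + g * hc
    · linear_combination C c₁ * h3 + C c₂ * h3' + f * hc
  by_cases h0 : coeff 0 w₁ = 0
  · exact ⟨1, 0, Or.inl one_ne_zero, key _ _ (by rw [← hw₁, h0]; simp)⟩
  · refine ⟨coeff 0 w₂, - coeff 0 w₁, Or.inr (neg_ne_zero.2 h0), key _ _ ?_⟩
    rw [C_neg, hw₁, hw₂]; ring

end BinaryForms

/-! ### Restriction of forms to a line. -/

section Line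

variable {k : Type*} [Field k]

/-- The linear form `X₀ - α X₁ - β X₂`. -/
noncomputable def lineForm (α β : k) : MvPolynomial (Fin 3) k :=
  X 0 - C α * X 1 - C β * X 2

/-- Restriction of forms to the line `X₀ = α X₁ + β X₂`. -/
noncomputable def restrictLine (α β : k) : MvPolynomial (Fin 3) k →ₐ[k] MvPolynomial (Fin 2) k :=
  aeval ![C α * X 0 + C β * X 1, X 0, X 1]

/-- The section of `restrictLine`. -/
noncomputable def extendLine : MvPolynomial (Fin 2) k →ₐ[k] MvPolynomial (Fin 3) k :=
  rename Fin.succ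

variable (α β : k)

theorem isHomogeneous_lineForm : (lineForm α β).IsHomogeneous 1 :=
  ((isHomogeneous_X k _).sub (isHomogeneous_C_mul_X α _)).sub (isHomogeneous_C_mul_X β _)

theorem restrictLine_lineForm : restrictLine α β (lineForm α β) = 0 := by
  simp [restrictLine, lineForm, MvPolynomial.algebraMap_eq]

theorem restrictLine_extendLine (p : MvPolynomial (Fin 2) k) :
    restrictLine α β (extendLine p) = p := by
  have : (restrictLine α β).comp extendLine = AlgHom.id k _ := by
    ext i
    fin_cases i <;> simp [restrictLine, extendLine]
  exact DFunLike.congr_fun this p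

theorem isHomogeneous_restrictLine {P : MvPolynomial (Fin 3) k} {d : ℕ} (hP : P.IsHomogeneous d) :
    (restrictLine α β P).IsHomogeneous d := by
  have := hP.aeval (![C α * X 0 + C β * X 1, X 0, X 1] : Fin 3 → MvPolynomial (Fin 2) k) (n := 1)
    (fun i => by
      fin_cases i
      · exact (isHomogeneous_C_mul_X α _).add (isHomogeneous_C_mul_X β _)
      · exact isHomogeneous_X k _
      · exact isHomogeneous_X k _)
  rwa [one_mul] at this

theorem isHomogeneous_extendLine {p : MvPolynomial (Fin 2) k} {d : ℕ} (hp : p.IsHomogeneous d) :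
    (extendLine p).IsHomogeneous d :=
  hp.rename_isHomogeneous

theorem restrictLine_X_succ_mul (i : Fin 2) (P : MvPolynomial (Fin 3) k) :
    restrictLine α β (X i.succ * P) = X i * restrictLine α β P := by
  rw [map_mul]
  congr 1
  fin_cases i <;> simp [restrictLine]

/-- Modulo the line form, `X 0` equals αX₁ + βX₂, so restricting and extending back is the identity
on the quotient ring. -/
theorem exists_eq_extendLine_add (P : MvPolynomial (Fin 3) k) :
    ∃ Q, P - extendLine (restrictLine α β P) = Q * lineForm α β := by
  have : ((Ideal.Quotient.mkₐ k (Ideal.span {lineForm α β})).comp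
      (extendLine.comp (restrictLine α β))) = Ideal.Quotient.mkₐ k _ := by
    ext i
    simp only [AlgHom.comp_apply, Ideal.Quotient.mkₐ_eq_mk]
    rw [eq_comm, Ideal.Quotient.eq, Ideal.mem_span_singleton]
    fin_cases i
    · exact ⟨1, by simp [restrictLine, extendLine, lineForm]; ring⟩
    · simp [restrictLine, extendLine]
    · simp [restrictLine, extendLine]
  have h := DFunLike.congr_fun this P
  simp only [AlgHom.comp_apply, Ideal.Quotient.mkₐ_eq_mk] at h
  rw [eq_comm, Ideal.Quotient.eq, Ideal.mem_span_singleton] at h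
  obtain ⟨Q, hQ⟩ := h
  exact ⟨Q, by rw [hQ, mul_comm]⟩

end Line

/-! ### The filtration of A by degree, and its duality. -/

section Filtration

variable (k : Type*) [Field k] {A : Type*} [CommRing A] [Algebra k A]

/-- The values on `Spec A` of the forms of degree `d`, for the homogeneous coordinates `c`. -/
noncomputable def formValues (c : Fin 3 → A) (d : ℕ) : Submodule k A :=
  (homogeneousSubmodule (Fin 3) k d).map (aeval c).toLinearMap

variable {k}

theorem mem_formValues {c : Fin 3 → A} {d : ℕ} {x : A} :
    x ∈ formValues k c d ↔ ∃ P : MvPolynomial (Fin 3) k, P.IsHomogeneous d ∧ aeval c P = x :=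
  Iff.rfl

theorem mul_mem_formValues {c : Fin 3 → A} {d e : ℕ} {x y : A} (hx : x ∈ formValues k c d)
    (hy : y ∈ formValues k c e) : x * y ∈ formValues k c (d + e) := by
  obtain ⟨P, hP, rfl⟩ := mem_formValues.1 hx
  obtain ⟨Q, hQ, rfl⟩ := mem_formValues.1 hy
  exact mem_formValues.2 ⟨P * Q, hP.mul hQ, map_mul _ _ _⟩

theorem coord_mem_formValues (c : Fin 3 → A) (i : Fin 3) : c i ∈ formValues k c 1 :=
  mem_formValues.2 ⟨X i, isHomogeneous_X k i, aeval_X _ _⟩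

theorem one_mem_formValues (c : Fin 3 → A) : (1 : A) ∈ formValues k c 0 :=
  mem_formValues.2 ⟨1, isHomogeneous_one _ _, map_one _⟩

/-- The homogeneous coordinates `c` of a closed embedding of `Spec A` whose homogeneous ideal is
generated by the cubic forms `F`, `G`, normalized by the condition that `X₀ - α X₁ - β X₂` takes the
value `1`. -/
structure IsNormalizedCubicIntersection (α β : k) (F G : MvPolynomial (Fin 3) k)
    (c : Fin 3 → A) : Prop where
  isHomogeneous_left : F.IsHomogeneous 3
  isHomogeneous_right : G.IsHomogeneous 3
  aeval_eq_zero_iff : ∀ (d : ℕ) (P : MvPolynomial (Fin 3) k), P.IsHomogeneous d →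
    (aeval c P = 0 ↔ P ∈ Ideal.span {F, G})
  exists_formValues_eq_top : ∃ d, formValues k c d = ⊤
  aeval_lineForm : aeval c (lineForm α β) = 1

namespace IsNormalizedCubicIntersection

variable {α β : k} {F G : MvPolynomial (Fin 3) k} {c : Fin 3 → A}

theorem formValues_le_succ (h : IsNormalizedCubicIntersection α β F G c) (d : ℕ) :
    formValues k c d ≤ formValues k c (d + 1) := by
  rintro _ ⟨P, hP, rfl⟩
  exact mem_formValues.2 ⟨P * lineForm α β, IsHomogeneous.mul hP (isHomogeneous_lineForm α β), by
    simp [h.aeval_lineForm]⟩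

theorem formValues_mono (h : IsNormalizedCubicIntersection α β F G c) :
    Monotone (formValues k c) :=
  monotone_nat_of_le_succ h.formValues_le_succ

/-- This identifies the graded pieces of the filtration with those of k[s,t]/(f,g): a value lies one
step lower exactly when, modulo (F, G), its form is divisible by the line form, whose value is 1. -/
theorem aeval_mem_formValues_iff (h : IsNormalizedCubicIntersection α β F G c) {d : ℕ}
    {P : MvPolynomial (Fin 3) k} (hP : P.IsHomogeneous (d + 1)) :
    aeval c P ∈ formValues k c d ↔
      restrictLine α β P ∈ Ideal.span {restrictLine α β F, restrictLine α β G} := by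
  constructor
  · intro hx
    obtain ⟨Q, hQ, hQP⟩ := mem_formValues.1 hx
    have h0 := (h.aeval_eq_zero_iff (d + 1) (P - Q * lineForm α β)
      (hP.sub (hQ.mul (isHomogeneous_lineForm α β)))).1 (by simp [h.aeval_lineForm, hQP])
    obtain ⟨u, v, huv⟩ := Ideal.mem_span_pair.1 h0
    refine Ideal.mem_span_pair.2 ⟨restrictLine α β u, restrictLine α β v, ?_⟩
    rw [← map_mul, ← map_mul, ← map_add, huv, map_sub, map_mul, restrictLine_lineForm, mul_zero,
      sub_zero]
  · intro hx
    obtain ⟨u, v, huv⟩ := Ideal.mem_span_pair.1 hx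
    obtain ⟨Q₁, hQ₁⟩ := exists_eq_extendLine_add α β (P - extendLine u * F - extendLine v * G)
    have h0 : restrictLine α β (P - extendLine u * F - extendLine v * G) = 0 := by
      simp only [map_sub, map_mul, restrictLine_extendLine]
      rw [← huv]; ring
    rw [h0, map_zero, sub_zero] at hQ₁
    -- The cofactors u, v need not be homogeneous, so only components of degree d + 1 are kept.
    have hdvd : ∀ p q : MvPolynomial (Fin 3) k, q.IsHomogeneous 3 → q ∈ Ideal.span {F, G} →
        homogeneousComponent (d + 1) (p * q) ∈ Ideal.span {F, G} := fun p q hq hqI =>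
      Ideal.mem_of_dvd _ (dvd_homogeneousComponent_mul hq p _) hqI
    have hQ := homogeneousComponent_isHomogeneous d Q₁
    have hsum : P - homogeneousComponent d Q₁ * lineForm α β ∈ Ideal.span {F, G} := by
      rw [← homogeneousComponent_mul_of_isHomogeneous (isHomogeneous_lineForm α β), ← hQ₁, map_sub,
        map_sub, homogeneousComponent_eq_self hP, sub_sub, sub_sub_cancel]
      exact add_mem
        (hdvd _ _ h.isHomogeneous_left (Ideal.subset_span (by simp)))
        (hdvd _ _ h.isHomogeneous_right (Ideal.subset_span (by simp)))
    rw [← h.aeval_eq_zero_iff (d + 1) _ (hP.sub (hQ.mul (isHomogeneous_lineForm α β))), map_sub,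
      map_mul, h.aeval_lineForm, mul_one, sub_eq_zero] at hsum
    exact mem_formValues.2 ⟨_, hQ, hsum.symm⟩

/-- Once the filtration has reached A, high powers of both variables lie in (f, g), so a common
divisor of f and g divides both powers. -/
theorem restrictLine_isRelPrime (h : IsNormalizedCubicIntersection α β F G c) :
    IsRelPrime (restrictLine α β F) (restrictLine α β G) := by
  obtain ⟨d, hd⟩ := h.exists_formValues_eq_top
  intro p hpF hpG
  have hX : ∀ i : Fin 2, p ∣ X i ^ (d + 1) := fun i => by
    have hmem : aeval c (extendLine (X i ^ (d + 1) : MvPolynomial (Fin 2) k)) ∈ formValues k c d :=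
      hd ▸ Submodule.mem_top
    rw [h.aeval_mem_formValues_iff (isHomogeneous_extendLine (isHomogeneous_X_pow _ _)),
      restrictLine_extendLine] at hmem
    obtain ⟨u, v, huv⟩ := Ideal.mem_span_pair.1 hmem
    rw [← huv]
    exact dvd_add (hpF.mul_left _) (hpG.mul_left _)
  have hrel : IsRelPrime (X 0 ^ (d + 1) : MvPolynomial (Fin 2) k) (X 1 ^ (d + 1)) := by
    refine IsRelPrime.pow ?_
    rw [X_prime.irreducible.isRelPrime_iff_not_dvd]
    exact X_ne_mul_X (by decide)
  exact hrel (hX 0) (hX 1)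

theorem restrictLine_ne_zero (h : IsNormalizedCubicIntersection α β F G c) :
    restrictLine α β G ≠ 0 := by
  intro h0
  have h1 := h.restrictLine_isRelPrime
  rw [h0, isRelPrime_zero_right] at h1
  have h2 := (isHomogeneous_restrictLine α β h.isHomogeneous_left)
  have h3 := h2.totalDegree h1.ne_zero
  rw [MvPolynomial.isUnit_iff_totalDegree_of_isReduced] at h1
  omega

/-- The class of y in V_{j+1}/V_j is a socle element of degree j + 1, and the only degree where the
socle may be nonzero is 4. -/
theorem mem_formValues_of_coord_mul_mem (h : IsNormalizedCubicIntersection α β F G c) {j : ℕ}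
    (hj : j ≠ 3) {y : A} (hy : y ∈ formValues k c (j + 1))
    (hc : ∀ i, c i * y ∈ formValues k c (j + 1)) : y ∈ formValues k c j := by
  obtain ⟨P, hP, rfl⟩ := mem_formValues.1 hy
  rw [h.aeval_mem_formValues_iff hP]
  refine mem_span_pair_of_X_mul_mem (isHomogeneous_restrictLine α β h.isHomogeneous_left)
    (isHomogeneous_restrictLine α β h.isHomogeneous_right) h.restrictLine_isRelPrime
    h.restrictLine_ne_zero (j := j + 1) (by omega) (isHomogeneous_restrictLine α β hP) fun i => ?_
  rw [← restrictLine_X_succ_mul, ← h.aeval_mem_formValues_iff (isHomogeneous_X_mul hP _), map_mul, aeval_X]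
  exact hc _

/-- If V_{n+5} = A, everything in its top graded piece is socle, hence zero in degree n + 5 > 4; so
V_{n+4} = A, and one descends. -/
theorem formValues_four (h : IsNormalizedCubicIntersection α β F G c) :
    formValues k c 4 = ⊤ := by
  obtain ⟨d, hd⟩ := h.exists_formValues_eq_top
  have key : ∀ n, formValues k c (n + 4) = ⊤ → formValues k c 4 = ⊤ := by
    intro n
    induction n with
    | zero => exact fun h => by simpa using h
    | succ n ih =>
      intro hn
      rw [show n + 1 + 4 = n + 4 + 1 by ring] at hn
      refine ih (eq_top_iff.2 fun y _ => ?_)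
      exact h.mem_formValues_of_coord_mul_mem (by omega) (hn ▸ Submodule.mem_top)
        fun i => hn ▸ Submodule.mem_top
  exact key d (top_unique (hd ▸ h.formValues_mono (by omega)))

theorem exists_smul_add_smul_mem (h : IsNormalizedCubicIntersection α β F G c) (x y : A) :
    ∃ c₁ c₂ : k, (c₁ ≠ 0 ∨ c₂ ≠ 0) ∧ c₁ • x + c₂ • y ∈ formValues k c 3 := by
  have htop : ∀ z : A, z ∈ formValues k c 4 := fun z => h.formValues_four ▸ Submodule.mem_top
  obtain ⟨P, hP, rfl⟩ := mem_formValues.1 (htop x)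
  obtain ⟨Q, hQ, rfl⟩ := mem_formValues.1 (htop y)
  have hX : ∀ P : MvPolynomial (Fin 3) k, P.IsHomogeneous 4 → ∀ i, X i * restrictLine α β P ∈
      Ideal.span {restrictLine α β F, restrictLine α β G} := fun P hP i => by
    rw [← restrictLine_X_succ_mul, ← h.aeval_mem_formValues_iff (isHomogeneous_X_mul hP _)]
    exact htop _
  obtain ⟨c₁, c₂, hc, hmem⟩ := exists_linear_relation
    (isHomogeneous_restrictLine α β h.isHomogeneous_left)
    (isHomogeneous_restrictLine α β h.isHomogeneous_right) h.restrictLine_isRelPrime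
    h.restrictLine_ne_zero (isHomogeneous_restrictLine α β hP) (isHomogeneous_restrictLine α β hQ)
    (hX P hP) (hX Q hQ)
  refine ⟨c₁, c₂, hc, ?_⟩
  have hlin : (C c₁ * P + C c₂ * Q).IsHomogeneous (3 + 1) := (hP.C_mul _).add (hQ.C_mul _)
  have := (h.aeval_mem_formValues_iff hlin).2 (by simpa [MvPolynomial.algebraMap_eq] using hmem)
  simpa [Algebra.smul_def] using this

theorem eq_zero_of_aeval_eq_zero (h : IsNormalizedCubicIntersection α β F G c) {d : ℕ} (hd : d < 3)
    {P : MvPolynomial (Fin 3) k} (hP : P.IsHomogeneous d) (h0 : aeval c P = 0) : P = 0 :=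
  eq_zero_of_mem_span_pair_of_lt hP h.isHomogeneous_left h.isHomogeneous_right
    ((h.aeval_eq_zero_iff d P hP).1 h0) hd

/-- The bottom case of the socle argument: a nonzero constant r with r c₁ constant would give a
nonzero linear form vanishing on Γ. -/
theorem eq_zero_of_coord_mul_mem (h : IsNormalizedCubicIntersection α β F G c) {y : A}
    (hy : y ∈ formValues k c 0) (hc : ∀ i, c i * y ∈ formValues k c 0) : y = 0 := by
  have hconst : ∀ z ∈ formValues k c 0, ∃ r : k, z = algebraMap k A r := fun z hz => by
    obtain ⟨P, hP, rfl⟩ := mem_formValues.1 hz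
    obtain ⟨r, rfl⟩ : ∃ r, P = C r :=
      ⟨_, by rw [← homogeneousComponent_zero, homogeneousComponent_eq_self hP]⟩
    exact ⟨r, aeval_C _ _⟩
  obtain ⟨r, rfl⟩ := hconst y hy
  obtain ⟨s, hs⟩ := hconst _ (hc 1)
  have h0 := h.eq_zero_of_aeval_eq_zero (P := C r * X 1 - C s * lineForm α β) (by norm_num)
    ((isHomogeneous_C_mul_X r 1).sub ((isHomogeneous_lineForm α β).C_mul s))
    (by simp only [map_sub, map_mul, aeval_X, aeval_C, h.aeval_lineForm]; rw [mul_comm, hs]; ring)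
  have h1 := congrArg (restrictLine α β) h0
  simp only [map_sub, map_mul, restrictLine_lineForm, mul_zero, sub_zero, map_zero] at h1
  have h2 : restrictLine α β (C r) * X 0 = 0 := by simpa [restrictLine] using h1
  have h3 := (mul_eq_zero.1 h2).resolve_right (X_ne_zero 0)
  have hr : r = 0 := by simpa [restrictLine] using h3
  rw [hr, map_zero]

/-- Induction on i: both y and the products `c m * y` satisfy the hypothesis for i - 1, hence lie in
V_{n+1}, and the absence of socle in degree n + 1 < 4 puts y in V_n. -/
theorem mem_formValues_of_mul_mem (h : IsNormalizedCubicIntersection α β F G c) {i n : ℕ}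
    (hin : i + n = 3) {y : A} (hy : ∀ x ∈ formValues k c i, y * x ∈ formValues k c 3) :
    y ∈ formValues k c n := by
  induction i generalizing n y with
  | zero =>
    obtain rfl : n = 3 := by omega
    simpa using hy 1 (one_mem_formValues c)
  | succ i ih =>
    refine h.mem_formValues_of_coord_mul_mem (by omega)
      (ih (by omega) fun x hx => hy x (h.formValues_le_succ i hx)) fun m => ih (by omega) ?_
    intro x hx
    have := hy (x * c m) (mul_mem_formValues hx (coord_mem_formValues c m))
    rwa [show c m * y * x = y * (x * c m) by ring]

theorem eq_zero_of_forall_mul_mem (h : IsNormalizedCubicIntersection α β F G c) {y : A}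
    (hy : ∀ x, y * x ∈ formValues k c 3) : y = 0 := by
  refine h.eq_zero_of_coord_mul_mem
    (h.mem_formValues_of_mul_mem (i := 3) rfl fun x _ => hy x) fun m =>
    h.mem_formValues_of_mul_mem (i := 3) rfl fun x _ => ?_
  rw [show c m * y * x = y * (x * c m) by ring]
  exact hy _

theorem nontrivial (h : IsNormalizedCubicIntersection α β F G c) : Nontrivial A := by
  refine ⟨1, 0, fun h0 => ?_⟩
  exact one_ne_zero (h.eq_zero_of_aeval_eq_zero (P := 1) (by norm_num)
    (isHomogeneous_one _ _) (by rw [map_one, h0]))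

theorem exists_ker_eq (h : IsNormalizedCubicIntersection α β F G c) :
    ∃ φ : A →ₗ[k] k, ∀ x, φ x = 0 ↔ x ∈ formValues k c 3 := by
  have := h.nontrivial
  obtain ⟨e, he⟩ : ∃ e, e ∉ formValues k c 3 := by
    by_contra! hall
    exact one_ne_zero (h.eq_zero_of_forall_mul_mem (y := 1) fun x => hall _)
  obtain ⟨φ, hφe, hφ⟩ := Submodule.exists_le_ker_of_notMem he
  refine ⟨φ, fun x => ⟨fun hx => ?_, fun hx => hφ hx⟩⟩
  obtain ⟨r, s, hrs, hmem⟩ := h.exists_smul_add_smul_mem e x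
  have h0 : φ (r • e + s • x) = 0 := hφ hmem
  rw [map_add, map_smul, map_smul, hx, smul_zero, add_zero, smul_eq_zero] at h0
  -- Here A/V_3 is at most one-dimensional: the relation between e and x cannot involve e, since
  -- φ(e) ≠ 0.
  obtain rfl := h0.resolve_right hφe
  have hs : s ≠ 0 := hrs.resolve_left (by simp)
  rw [zero_smul, zero_add] at hmem
  exact (Submodule.smul_mem_iff _ hs).1 hmem

theorem exists_dualizingGenerator [Module.Finite k A]
    (h : IsNormalizedCubicIntersection α β F G c) :
    ∃ φ : A →ₗ[k] k, IsDualizingGenerator k φ ∧ ∀ i n, i + n = 3 → ∀ y,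
      (y ∈ formValues k c n ↔ ∀ x ∈ formValues k c i, φ (y * x) = 0) := by
  obtain ⟨φ, hφ⟩ := h.exists_ker_eq
  refine ⟨φ, ?_, fun i n hin y => ?_⟩
  · let B : A →ₗ[k] Module.Dual k A := (LinearMap.mul k A).compr₂ φ
    have hB : Function.Injective B := by
      rw [← LinearMap.ker_eq_bot, LinearMap.ker_eq_bot']
      intro y hy
      refine h.eq_zero_of_forall_mul_mem fun x => (hφ _).1 ?_
      exact DFunLike.congr_fun hy x
    intro ψ
    obtain ⟨x, hx⟩ := (LinearMap.injective_iff_surjective_of_finrank_eq_finrank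
      (Subspace.dual_finrank_eq (K := k) (V := A)).symm).1 hB ψ
    exact ⟨x, fun y => by rw [← hx]; rfl⟩
  · simp only [hφ]
    refine ⟨fun hy x hx => ?_, fun hy => h.mem_formValues_of_mul_mem hin hy⟩
    have := mul_mem_formValues hy hx
    rwa [add_comm, hin] at this

end IsNormalizedCubicIntersection

end Filtration

/-! ### A line missing Γ, and rescaling of coordinates. -/

section Normalization

variable {k : Type*} [Field k] {A : Type*} [CommRing A] [Algebra k A]

theorem aeval_mul_of_isHomogeneous {σ : Type*} {P : MvPolynomial σ k} {d : ℕ}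
    (hP : P.IsHomogeneous d) (v : A) (c : σ → A) :
    aeval (fun i => v * c i) P = v ^ d * aeval c P := by
  rw [aeval_def, aeval_def, eval₂_eq, eval₂_eq, Finset.mul_sum]
  refine Finset.sum_congr rfl fun m hm => ?_
  have hd : ∑ i ∈ m.support, m i = d := by
    rw [← Finsupp.degree_apply, hP.degree_eq_sum_deg_support hm]
    rfl
  simp_rw [mul_pow]
  rw [Finset.prod_mul_distrib, Finset.prod_pow_eq_pow_sum, hd]
  ring

theorem mem_formValues_mul_iff (v : Aˣ) (c : Fin 3 → A) (d : ℕ) (x : A) :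
    x ∈ formValues k (fun i => (v : A) * c i) d ↔ (↑(v⁻¹ ^ d) : A) * x ∈ formValues k c d := by
  simp only [mem_formValues]
  refine exists_congr fun P => and_congr_right fun hP => ?_
  rw [aeval_mul_of_isHomogeneous hP, ← Units.val_pow_eq_pow_val, inv_pow, eq_comm,
    ← Units.inv_mul_eq_iff_eq_mul, eq_comm]

/-- An Artinian ring has finitely many maximal ideals, and each one excludes at most one value of r.
-/
theorem exists_add_mul_notMem [Infinite k] [Module.Finite k A] (x y : A) :
    ∃ r : k, ∀ m : Ideal A, m.IsMaximal → x + algebraMap k A r * y ∈ m → x ∈ m ∧ y ∈ m := by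
  have : IsArtinianRing A := IsArtinianRing.of_finite k A
  have hfin : (⋃ m : MaximalSpectrum A, {r : k | x + algebraMap k A r * y ∈ m.asIdeal ∧
      ¬ (x ∈ m.asIdeal ∧ y ∈ m.asIdeal)}).Finite := by
    refine Set.finite_iUnion fun m => Set.Subsingleton.finite ?_
    rintro r ⟨hr, hxy⟩ s ⟨hs, -⟩
    by_contra hrs
    have hy : y ∈ m.asIdeal := by
      have h1 : algebraMap k A (r - s) * y ∈ m.asIdeal := by
        have := sub_mem hr hs
        rwa [show x + algebraMap k A r * y - (x + algebraMap k A s * y) =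
          algebraMap k A (r - s) * y by rw [map_sub]; ring] at this
      have hu : IsUnit (algebraMap k A (r - s)) := (sub_ne_zero.2 hrs).isUnit.map _
      exact (Ideal.unit_mul_mem_iff_mem _ hu).1 h1
    exact hxy ⟨(add_mem_cancel_right (Ideal.mul_mem_left _ _ hy)).1 hr, hy⟩
  obtain ⟨r, hr⟩ := hfin.exists_notMem
  refine ⟨r, fun m hm hmem => ?_⟩
  by_contra hxy
  exact hr (Set.mem_iUnion.2 ⟨⟨m, hm⟩, hmem, hxy⟩)

theorem exists_isUnit_aeval_lineForm [Infinite k] [Module.Finite k A] {a : Fin 3 → A}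
    (ha : IsProjPoint a) : ∃ α β : k, IsUnit (aeval a (lineForm α β)) := by
  obtain ⟨r, hr⟩ := exists_add_mul_notMem (k := k) (a 1) (a 2)
  obtain ⟨s, hs⟩ := exists_add_mul_notMem (k := k) (a 0) (a 1 + algebraMap k A r * a 2)
  refine ⟨-s, -(s * r), ?_⟩
  by_contra hu
  obtain ⟨m, hm, hmem⟩ := exists_max_ideal_of_mem_nonunits hu
  have heq : aeval a (lineForm (-s) (-(s * r))) =
      a 0 + algebraMap k A s * (a 1 + algebraMap k A r * a 2) := by
    simp [lineForm]; ring
  rw [heq] at hmem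
  obtain ⟨h0, h⟩ := hs m hm hmem
  obtain ⟨h1, h2⟩ := hr m hm h
  refine hm.ne_top (top_unique (ha ▸ Ideal.span_le.2 ?_))
  rintro _ ⟨i, rfl⟩
  fin_cases i
  exacts [h0, h1, h2]

theorem IsCompleteIntersection.exists_normalized [Infinite k] [Module.Finite k A] {a : Fin 3 → A}
    (ha : IsCompleteIntersection k 3 3 a) :
    ∃ (v : Aˣ) (α β : k) (F G : MvPolynomial (Fin 3) k) (c : Fin 3 → A),
      a = (fun i => (v : A) * c i) ∧ IsNormalizedCubicIntersection α β F G c := by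
  obtain ⟨⟨hproj, d, hd⟩, F, G, hF, hG, -, hI⟩ := ha
  obtain ⟨α, β, v, hv⟩ := exists_isUnit_aeval_lineForm (k := k) hproj
  have hac : a = fun i => (v : A) * ((↑v⁻¹ : A) * a i) := by
    funext i
    rw [Units.mul_inv_cancel_left]
  refine ⟨v, α, β, F, G, fun i => (↑v⁻¹ : A) * a i, hac, hF, hG, fun e P hP => ?_, ⟨d, ?_⟩, ?_⟩
  · rw [← hI e P hP, aeval_mul_of_isHomogeneous hP, ← Units.val_pow_eq_pow_val, Units.mul_right_eq_zero]
  · refine eq_top_iff.2 fun x _ => ?_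
    obtain ⟨P, hP, hPx⟩ := hd ((v : A) ^ d * x)
    refine mem_formValues.2 ⟨P, hP, ?_⟩
    rw [aeval_mul_of_isHomogeneous hP, hPx, ← mul_assoc, ← mul_pow, Units.inv_mul, one_pow, one_mul]
  · rw [aeval_mul_of_isHomogeneous (isHomogeneous_lineForm α β), ← hv, pow_one, Units.inv_mul]

theorem IsCompleteIntersection.eq_zero_of_aeval_eq_zero {a : Fin 3 → A}
    (ha : IsCompleteIntersection k 3 3 a) {d : ℕ} (hd : d < 3)
    {P : MvPolynomial (Fin 3) k} (hP : P.IsHomogeneous d) (h0 : aeval a P = 0) : P = 0 := by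
  obtain ⟨-, F, G, hF, hG, -, hI⟩ := ha
  exact eq_zero_of_mem_span_pair_of_lt hP hF hG ((hI d P hP).1 h0) hd

/-- Forms of degrees `i` and `3 - i` are mutual annihilators for a suitable duality pairing. -/
theorem IsCompleteIntersection.exists_dualizingGenerator [Infinite k] [Module.Finite k A]
    {a : Fin 3 → A} (ha : IsCompleteIntersection k 3 3 a) :
    ∃ φ : A →ₗ[k] k, IsDualizingGenerator k φ ∧ ∀ i n, i + n = 3 → ∀ y,
      (y ∈ formValues k a n ↔ ∀ x ∈ formValues k a i, φ (y * x) = 0) := by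
  obtain ⟨v, α, β, F, G, c, rfl, hc⟩ := ha.exists_normalized
  obtain ⟨φ, hφ, h⟩ := hc.exists_dualizingGenerator
  -- Rescaling by v multiplies values of degree i and n by v^i and v^n; as i + n = 3, twisting φ by
  -- v⁻³ compensates both.
  refine ⟨φ ∘ₗ LinearMap.mulLeft k (↑(v⁻¹ ^ 3) : A), fun ψ => ?_, fun i n hin y => ?_⟩
  · obtain ⟨x, hx⟩ := hφ ψ
    refine ⟨(↑(v ^ 3) : A) * x, fun y => ?_⟩
    rw [hx, LinearMap.comp_apply, LinearMap.mulLeft_apply, inv_pow, mul_assoc,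
      Units.inv_mul_cancel_left]
  · rw [mem_formValues_mul_iff, h i n hin]
    have hsplit : ∀ x, (↑(v⁻¹ ^ 3) : A) * (y * x) =
        (↑(v⁻¹ ^ n) : A) * y * ((↑(v⁻¹ ^ i) : A) * x) := fun x => by
      rw [← hin, pow_add, Units.val_mul]; ring
    simp only [LinearMap.comp_apply, LinearMap.mulLeft_apply, hsplit, mem_formValues_mul_iff]
    refine ⟨fun hy x hx => hy _ hx, fun hy x hx => ?_⟩
    have := hy ((↑(v ^ i) : A) * x)
    rw [inv_pow v i, Units.inv_mul_cancel_left] at this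
    exact this hx

end Normalization

/-! ### Bases of lines and conics, and their values on Γ. -/

section Basis

variable {k : Type*} [Field k]

theorem finrank_homogeneousSubmodule_two :
    Module.finrank k (homogeneousSubmodule (Fin 3) k 2) = 6 := by
  rw [homogeneousSubmodule_eq_finsupp_supported]
  have e := (AddMonoidAlgebra.supportedEquivFinsupp (R := k) (S := k) {d : Fin 3 →₀ ℕ | d.degree = 2})
  let s : Sym (Fin 3) 2 ≃ {d : Fin 3 →₀ ℕ | d.degree = 2} :=
    (Sym.equivNatSum (Fin 3) 2).trans (Equiv.refl _)
  refine (e.trans (Finsupp.domLCongr s.symm)).finrank_eq.trans ?_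
  rw [Module.finrank_finsupp_self, Sym.card_sym_eq_choose]
  rfl

theorem exists_isVeroneseMap : ∃ q : Fin 6 → MvPolynomial (Fin 3) k, IsVeroneseMap q := by
  have : Module.Finite k (homogeneousSubmodule (Fin 3) k 2) :=
    Module.finite_of_finrank_pos (by rw [finrank_homogeneousSubmodule_two]; norm_num)
  let b := Module.finBasisOfFinrankEq k _ (finrank_homogeneousSubmodule_two (k := k))
  refine ⟨fun i => b i, b.linearIndependent.map' (Submodule.subtype _) (Submodule.ker_subtype _), ?_⟩
  have h := congrArg (Submodule.map (Submodule.subtype _)) b.span_eq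
  rwa [Submodule.map_span, ← Set.range_comp, Submodule.map_top, Submodule.range_subtype] at h

theorem IsVeroneseMap.isHomogeneous {q : Fin 6 → MvPolynomial (Fin 3) k} (hq : IsVeroneseMap q)
    (i : Fin 6) : (q i).IsHomogeneous 2 := by
  rw [← mem_homogeneousSubmodule, ← hq.2]
  exact Submodule.subset_span ⟨i, rfl⟩

variable {A : Type*} [CommRing A] [Algebra k A]

theorem IsVeroneseMap.span_compPoint {q : Fin 6 → MvPolynomial (Fin 3) k} (hq : IsVeroneseMap q)
    (a : Fin 3 → A) : Submodule.span k (Set.range (compPoint q a)) = formValues k a 2 := by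
  rw [formValues, ← hq.2, Submodule.map_span, ← Set.range_comp]
  rfl

theorem formValues_one_eq_span (a : Fin 3 → A) :
    formValues k a 1 = Submodule.span k (Set.range a) := by
  rw [formValues, homogeneousSubmodule_one_eq_span_X, Submodule.map_span, ← Set.range_comp]
  congr 2
  funext i
  simp

theorem mem_formValues_one {a : Fin 3 → A} {x : A} :
    x ∈ formValues k a 1 ↔ ∃ r : Fin 3 → k, ∑ j, r j • a j = x := by
  rw [formValues_one_eq_span, Submodule.mem_span_range_iff_exists_fun]

theorem forall_formValues_one_iff {a : Fin 3 → A} (φ : A →ₗ[k] k) (y : A) :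
    (∀ x ∈ formValues k a 1, φ (y * x) = 0) ↔ ∀ i, φ (a i * y) = 0 := by
  refine ⟨fun h i => mul_comm y (a i) ▸ h _ (coord_mem_formValues a i), fun h x hx => ?_⟩
  obtain ⟨r, rfl⟩ := mem_formValues_one.1 hx
  rw [Finset.mul_sum, map_sum]
  exact Finset.sum_eq_zero fun i _ => by rw [mul_smul_comm, map_smul, mul_comm, h, smul_zero]

variable {a : Fin 3 → A}

theorem IsCompleteIntersection.linearIndependent_compPoint
    (ha : IsCompleteIntersection k 3 3 a) {ι : Type*} {d : ℕ} (hd : d < 3)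
    {q : ι → MvPolynomial (Fin 3) k} (hq : ∀ i, (q i).IsHomogeneous d)
    (hli : LinearIndependent k q) : LinearIndependent k (fun i => aeval a (q i)) := by
  refine hli.map_injOn (aeval a).toLinearMap fun x hx y hy hxy => ?_
  have hle : Submodule.span k (Set.range q) ≤ homogeneousSubmodule (Fin 3) k d :=
    Submodule.span_le.2 (by rintro _ ⟨i, rfl⟩; exact hq i)
  rw [← sub_eq_zero]
  refine ha.eq_zero_of_aeval_eq_zero hd ((hle hx).sub (hle hy)) ?_
  rw [map_sub, sub_eq_zero]
  exact hxy

theorem IsCompleteIntersection.linearIndependent (ha : IsCompleteIntersection k 3 3 a) :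
    LinearIndependent k a := by
  have h := ha.linearIndependent_compPoint (d := 1) (by norm_num) (isHomogeneous_X k)
    (linearIndependent_X (Fin 3) k)
  simpa using h

theorem IsCompleteIntersection.eq_of_aeval_eq (ha : IsCompleteIntersection k 3 3 a) {d : ℕ}
    (hd : d < 3) {P Q : MvPolynomial (Fin 3) k} (hP : P.IsHomogeneous d) (hQ : Q.IsHomogeneous d)
    (h : aeval a P = aeval a Q) : P = Q :=
  sub_eq_zero.1 (ha.eq_zero_of_aeval_eq_zero hd (hP.sub hQ) (by rw [map_sub, h, sub_self]))

theorem IsCompleteIntersection.nontrivial (ha : IsCompleteIntersection k 3 3 a) : Nontrivial A :=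
  ⟨1, 0, fun h0 => one_ne_zero (ha.eq_zero_of_aeval_eq_zero (P := 1) (by norm_num)
    (isHomogeneous_one _ _) (by rw [map_one, h0]))⟩

end Basis

/-! ### The Gale transform is a Veronese map. -/

section Gale

variable {k : Type*} [Field k] {A : Type*} [CommRing A] [Algebra k A]

theorem IsDualizingGenerator.eq_zero {φ : A →ₗ[k] k} (hφ : IsDualizingGenerator k φ) {y : A}
    (hy : ∀ x, φ (y * x) = 0) : y = 0 := by
  by_contra hy0
  obtain ⟨ψ, hψ⟩ : ∃ ψ : A →ₗ[k] k, ψ y ≠ 0 := by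
    by_contra! h
    exact hy0 ((Module.forall_dual_apply_eq_zero_iff k y).1 h)
  obtain ⟨x, hx⟩ := hφ ψ
  exact hψ (by rw [hx, mul_comm, hy])

/-- Each generator is a multiple of the other, and nondegeneracy makes the two multipliers inverse.
-/
theorem IsDualizingGenerator.exists_unit {φ ψ : A →ₗ[k] k} (hφ : IsDualizingGenerator k φ)
    (hψ : IsDualizingGenerator k ψ) : ∃ w : Aˣ, ∀ x, ψ x = φ (w * x) := by
  obtain ⟨w, hw⟩ := hφ ψ
  obtain ⟨w', hw'⟩ := hψ φ
  have h : w * w' = 1 := by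
    rw [← sub_eq_zero]
    refine hφ.eq_zero fun x => ?_
    rw [sub_mul, map_sub, one_mul, mul_assoc, ← hw, ← hw', sub_self]
  exact ⟨⟨w, w', h, by rw [mul_comm, h]⟩, hw⟩

variable [Infinite k] [Module.Finite k A] {a : Fin 3 → A}

theorem IsCompleteIntersection.exists_isGaleTransform (ha : IsCompleteIntersection k 3 3 a) :
    ∃ b : Fin 6 → A, IsGaleTransform k a b := by
  obtain ⟨q, hq⟩ := exists_isVeroneseMap (k := k)
  obtain ⟨φ, hφ, h⟩ := ha.exists_dualizingGenerator
  refine ⟨compPoint q a, ha.linearIndependent,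
    ha.linearIndependent_compPoint (d := 2) (by norm_num) hq.isHomogeneous hq.1, φ, hφ, fun y => ?_⟩
  rw [hq.span_compPoint, h 1 2 rfl, forall_formValues_one_iff]

theorem IsGaleTransform.exists_unit (ha : IsCompleteIntersection k 3 3 a) {b : Fin 6 → A}
    (hb : IsGaleTransform k a b) :
    ∃ w : Aˣ, ∀ y, y ∈ Submodule.span k (Set.range b) ↔ (w : A) * y ∈ formValues k a 2 := by
  obtain ⟨-, -, ψ, hψ, hab⟩ := hb
  obtain ⟨φ, hφ, h⟩ := ha.exists_dualizingGenerator
  obtain ⟨w, hw⟩ := hφ.exists_unit hψ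
  refine ⟨w, fun y => ?_⟩
  rw [hab, h 1 2 rfl, forall_formValues_one_iff]
  simp only [hw, mul_left_comm]

/-- Up to a unit, the span of b contains all products `a i * a j`, which generate the square of the
unit ideal. -/
theorem IsGaleTransform.isProjPoint (ha : IsCompleteIntersection k 3 3 a) {b : Fin 6 → A}
    (hb : IsGaleTransform k a b) : IsProjPoint b := by
  obtain ⟨w, hw⟩ := hb.exists_unit ha
  have hspan : ∀ y, y ∈ Submodule.span k (Set.range b) → y ∈ Ideal.span (Set.range b) :=
    fun y hy => Submodule.span_le_restrictScalars k A _ hy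
  have hmem : ∀ y ∈ formValues k a 2, y ∈ Ideal.span (Set.range b) := fun y hy => by
    have := hspan (↑w⁻¹ * y) ((hw _).2 (by rwa [Units.mul_inv_cancel_left]))
    simpa using Ideal.mul_mem_left _ (w : A) this
  have htop : Ideal.span (Set.range a) * Ideal.span (Set.range a) = ⊤ := by
    rw [show Ideal.span (Set.range a) = ⊤ from ha.1.1, Ideal.mul_top]
  refine top_unique (htop ▸ ?_)
  rw [Ideal.span_mul_span']
  refine Ideal.span_le.2 ?_
  rintro _ ⟨_, ⟨i, rfl⟩, _, ⟨j, rfl⟩, rfl⟩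
  exact hmem _ (mul_mem_formValues (coord_mem_formValues a i) (coord_mem_formValues a j))

theorem IsGaleTransform.exists_isVeroneseMap (ha : IsCompleteIntersection k 3 3 a) {b : Fin 6 → A}
    (hb : IsGaleTransform k a b) : ∃ q : Fin 6 → MvPolynomial (Fin 3) k,
      IsVeroneseMap q ∧ SameProjPoint b (compPoint q a) := by
  obtain ⟨w, hw⟩ := hb.exists_unit ha
  have hq : ∀ i, ∃ P : MvPolynomial (Fin 3) k, P.IsHomogeneous 2 ∧ aeval a P = w * b i :=
    fun i => mem_formValues.1 ((hw _).1 (Submodule.subset_span ⟨i, rfl⟩))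
  choose q hq hqb using hq
  refine ⟨q, ⟨?_, le_antisymm (Submodule.span_le.2 ?_) fun P hP => ?_⟩, w, hqb⟩
  · have hli : LinearIndependent k (fun i => (w : A) * b i) :=
      hb.2.1.map' (LinearMap.mulLeft k (w : A)) (LinearMap.ker_eq_bot.2 w.isUnit.mul_right_injective)
    refine LinearIndependent.of_comp (aeval a).toLinearMap ?_
    convert hli using 1
    funext i
    exact hqb i
  · rintro _ ⟨i, rfl⟩
    exact hq i
  · have hmem : (↑w⁻¹ : A) * aeval a P ∈ Submodule.span k (Set.range b) := by
      rw [hw, Units.mul_inv_cancel_left]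
      exact mem_formValues.2 ⟨P, hP, rfl⟩
    obtain ⟨r, hr⟩ := (Submodule.mem_span_range_iff_exists_fun k).1 hmem
    refine (Submodule.mem_span_range_iff_exists_fun k).2 ⟨r, ?_⟩
    refine ha.eq_of_aeval_eq (d := 2) (by norm_num)
      (IsHomogeneous.sum _ _ _ fun i _ => by rw [smul_eq_C_mul]; exact (hq i).C_mul _) hP ?_
    rw [map_sum, ← Units.mul_inv_cancel_left w (aeval a P), ← hr, Finset.mul_sum]
    exact Finset.sum_congr rfl fun i _ => by rw [map_smul, hqb, mul_smul_comm]

end Gale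

/-! ### Uniqueness of the factorization. -/

section Uniqueness

variable {k : Type*} [Field k] {A : Type*} [CommRing A] [Algebra k A]

theorem eq_smul_one_of_X_mul_comm {N : Matrix (Fin 3) (Fin 3) k}
    (h : ∀ i j, X j * ∑ l, C (N i l) * X l = X i * (∑ l, C (N j l) * X l : MvPolynomial (Fin 3) k)) :
    ∃ r : k, ∀ i j, N i j = if i = j then r else 0 := by
  have hoff : ∀ i l, i ≠ l → N i l = 0 := fun i l hil => by
    obtain ⟨c, hc, -⟩ := exists_of_X_mul_eq_X_mul hil (h i l)
    -- The i-th linear form is divisible by `X i`, so it vanishes at the l-th coordinate point,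
    -- where its value is `N i l`.
    have h1 := congrArg (eval (Pi.single l 1)) hc
    simpa [Pi.single_apply, hil, hil.symm] using h1
  have hdiag : ∀ i j, i ≠ j → N i i = N j j := fun i j hij => by
    have h1 := congrArg (eval (Pi.single i 1 + Pi.single j 1)) (h i j)
    have h2 := hoff i j hij
    have h3 := hoff j i hij.symm
    simpa [Pi.single_apply, hij, hij.symm, h2, h3, mul_add, Finset.sum_add_distrib] using h1
  refine ⟨N 0 0, fun i j => ?_⟩
  split_ifs with hij
  · subst hij
    by_cases h0 : i = 0
    · rw [h0]
    · exact hdiag i 0 h0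
  · exact hoff i j hij

theorem isHomogeneous_linearForm (r : Fin 3 → k) :
    (∑ l, C (r l) * X l : MvPolynomial (Fin 3) k).IsHomogeneous 1 :=
  IsHomogeneous.sum _ _ _ fun l _ => isHomogeneous_C_mul_X (r l) l

theorem aeval_linearForm (a : Fin 3 → A) (r : Fin 3 → k) :
    aeval a (∑ l, C (r l) * X l : MvPolynomial (Fin 3) k) = ∑ l, r l • a l := by
  simp [Algebra.smul_def]

variable {a a' : Fin 3 → A}

/-- Only constants preserve the linear series of linear forms. -/
theorem IsCompleteIntersection.exists_eq_algebraMap (ha : IsCompleteIntersection k 3 3 a) {t : A}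
    (ht : ∀ x ∈ formValues k a 1, t * x ∈ formValues k a 1) : ∃ r : k, t = algebraMap k A r := by
  choose N hN using fun i => mem_formValues_one.1 (ht _ (coord_mem_formValues a i))
  -- The equality a_j (t a_i) = a_i (t a_j) in A lifts to an identity of quadratic forms, because no
  -- conic vanishes on Γ.
  obtain ⟨r, hr⟩ := eq_smul_one_of_X_mul_comm (N := N) fun i j => by
    refine ha.eq_of_aeval_eq (d := 2) (by norm_num)
      (isHomogeneous_X_mul (isHomogeneous_linearForm _) _)
      (isHomogeneous_X_mul (isHomogeneous_linearForm _) _) ?_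
    rw [map_mul, map_mul, aeval_linearForm, aeval_linearForm, hN, hN, aeval_X, aeval_X]
    ring
  refine ⟨r, ?_⟩
  have h0 : ∀ i, (t - algebraMap k A r) * a i = 0 := fun i => by
    rw [sub_mul, ← hN i, ← Algebra.smul_def, sub_eq_zero]
    simp [hr]
  have hle : Ideal.span (Set.range a) ≤ LinearMap.ker (LinearMap.mulLeft A (t - algebraMap k A r)) :=
    Ideal.span_le.2 (by rintro _ ⟨i, rfl⟩; exact h0 i)
  have h1 : (1 : A) ∈ Ideal.span (Set.range a) := by
    rw [show Ideal.span (Set.range a) = ⊤ from ha.1.1]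
    exact Submodule.mem_top
  have h2 : (t - algebraMap k A r) * 1 = 0 := hle h1
  rwa [mul_one, sub_eq_zero] at h2

theorem aeval_compMap (q : Fin 6 → MvPolynomial (Fin 3) k) (κ : GL (Fin 3) k) (a : Fin 3 → A)
    (i : Fin 6) :
    aeval a (compMap q (linearForms κ) i) = aeval (compPoint (linearForms κ) a) (q i) := by
  rw [compMap, aeval_bind₁]
  rfl

theorem isHomogeneous_compMap {q : Fin 6 → MvPolynomial (Fin 3) k} (hq : IsVeroneseMap q)
    (κ : GL (Fin 3) k) (i : Fin 6) : (compMap q (linearForms κ) i).IsHomogeneous 2 :=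
  (hq.isHomogeneous i).aeval _ fun _ => isHomogeneous_linearForm _

theorem exists_linearForms_of_mem (ha' : IsCompleteIntersection k 3 3 a') {r : Aˣ}
    (hr : ∀ y ∈ formValues k a' 1, (r : A) * y ∈ formValues k a 1) :
    ∃ κ : GL (Fin 3) k, ∀ i, compPoint (linearForms κ) a i = r * a' i := by
  choose N hN using fun i => mem_formValues_one.1 (hr _ (coord_mem_formValues a' i))
  have hli : LinearIndependent k (Matrix.row (N : Matrix (Fin 3) (Fin 3) k)) := by
    have h : LinearIndependent k (fun i => (r : A) * a' i) :=
      ha'.linearIndependent.map' (LinearMap.mulLeft k (r : A))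
        (LinearMap.ker_eq_bot.2 r.isUnit.mul_right_injective)
    refine LinearIndependent.of_comp (Fintype.linearCombination k a) ?_
    convert h using 1
    funext i
    exact hN i
  obtain ⟨κ, hκ⟩ := Matrix.linearIndependent_rows_iff_isUnit.1 hli
  refine ⟨κ, fun i => ?_⟩
  rw [← hN i, compPoint, linearForms, aeval_linearForm, hκ]

variable [Infinite k] [Module.Finite k A]

/-- The linear series of conics determines the linear series of lines. -/
theorem exists_unit_formValues_one (ha : IsCompleteIntersection k 3 3 a)
    (ha' : IsCompleteIntersection k 3 3 a') {t : Aˣ}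
    (ht : ∀ z, z ∈ formValues k a 2 ↔ (t : A) * z ∈ formValues k a' 2) :
    ∃ r : Aˣ, ∀ y, y ∈ formValues k a' 1 ↔ (r : A) * y ∈ formValues k a 1 := by
  obtain ⟨φ, hφ, h⟩ := ha.exists_dualizingGenerator
  obtain ⟨ψ, hψ, h'⟩ := ha'.exists_dualizingGenerator
  obtain ⟨w, hw⟩ := hφ.exists_unit hψ
  -- V_1 is the annihilator of V_2 on both sides; t carries one V_2 to the other and w carries one
  -- pairing to the other.
  refine ⟨w * t, fun y => ?_⟩
  rw [h' 2 1 rfl, h 2 1 rfl]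
  have key : ∀ z, ψ (y * (t * z)) = φ (↑(w * t) * y * z) := fun z => by
    rw [hw, Units.val_mul]
    congr 1
    ring
  refine ⟨fun hy z hz => ?_, fun hy z hz => ?_⟩
  · rw [← key]
    exact hy _ ((ht z).1 hz)
  · have hz' : (↑t⁻¹ : A) * z ∈ formValues k a 2 := by rwa [ht, Units.mul_inv_cancel_left]
    have := key (↑t⁻¹ * z)
    rw [Units.mul_inv_cancel_left, hy _ hz'] at this
    exact this

/-- Multiplication by t is self-adjoint for φ(xy), so preserving V_2 it also preserves the
annihilator V_1. -/
theorem IsCompleteIntersection.exists_eq_algebraMap_of_mul_mem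
    (ha : IsCompleteIntersection k 3 3 a) {t : A}
    (ht : ∀ x ∈ formValues k a 2, t * x ∈ formValues k a 2) : ∃ r : k, t = algebraMap k A r := by
  obtain ⟨φ, -, h⟩ := ha.exists_dualizingGenerator
  refine ha.exists_eq_algebraMap fun x hx => (h 2 1 rfl _).2 fun z hz => ?_
  rw [mul_comm t x, mul_assoc]
  exact (h 2 1 rfl x).1 hx _ (ht z hz)

theorem IsCompleteIntersection.exists_linearForms_of_sameProjPoint
    (ha : IsCompleteIntersection k 3 3 a) (ha' : IsCompleteIntersection k 3 3 a') {b : Fin 6 → A}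
    {q q' : Fin 6 → MvPolynomial (Fin 3) k} (hq : IsVeroneseMap q) (hq' : IsVeroneseMap q')
    (hb : SameProjPoint b (compPoint q a)) (hb' : SameProjPoint b (compPoint q' a')) :
    ∃ κ : GL (Fin 3) k, SameProjPoint a' (compPoint (linearForms κ) a) ∧
      SameMap q (compMap q' (linearForms κ)) := by
  obtain ⟨w, hw⟩ := hb
  obtain ⟨w', hw'⟩ := hb'
  have hqq : ∀ i, compPoint q' a' i = ↑(w' * w⁻¹) * compPoint q a i := fun i => by
    rw [hw, hw', Units.val_mul, mul_assoc, Units.inv_mul_cancel_left]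
  have ht : ∀ z, z ∈ formValues k a 2 ↔ (↑(w' * w⁻¹) : A) * z ∈ formValues k a' 2 := fun z => by
    rw [← hq.span_compPoint, ← hq'.span_compPoint,
      show compPoint q' a' = LinearMap.mulLeft k (↑(w' * w⁻¹) : A) ∘ compPoint q a from funext hqq,
      Set.range_comp, ← Submodule.map_span]
    exact (Function.Injective.mem_set_image
      (f := LinearMap.mulLeft k (↑(w' * w⁻¹) : A)) (w' * w⁻¹).isUnit.mul_right_injective).symm
  obtain ⟨r, hr⟩ := exists_unit_formValues_one ha ha' ht
  obtain ⟨κ, hκ⟩ := exists_linearForms_of_mem ha' fun y hy => (hr y).1 hy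
  refine ⟨κ, ⟨r, hκ⟩, ?_⟩
  have hcomp : ∀ i, aeval a (compMap q' (linearForms κ) i) =
      (r : A) ^ 2 * ↑(w' * w⁻¹) * aeval a (q i) := fun i => by
    rw [aeval_compMap, funext hκ, aeval_mul_of_isHomogeneous (hq'.isHomogeneous i), mul_assoc]
    exact congrArg _ (hqq i)
  -- The square comes from evaluating quadratic forms at r a'. This multiplier sends the spanning
  -- values of q to values of conics, so it preserves V_2.
  obtain ⟨c, hc⟩ := ha.exists_eq_algebraMap_of_mul_mem (t := (r : A) ^ 2 * ↑(w' * w⁻¹))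
    fun x hx => by
      rw [← hq.span_compPoint] at hx
      refine Submodule.span_induction ?_ (by simp) (fun x y _ _ hx hy => ?_) (fun s x _ hx => ?_) hx
      · rintro _ ⟨i, rfl⟩
        exact mem_formValues.2 ⟨_, isHomogeneous_compMap hq' κ i, hcomp i⟩
      · rw [mul_add]
        exact add_mem hx hy
      · rw [mul_smul_comm]
        exact Submodule.smul_mem _ s hx
  refine ⟨c, ?_, fun i => ?_⟩
  · rintro rfl
    have := ha.nontrivial
    have hu : IsUnit ((r : A) ^ 2 * ↑(w' * w⁻¹)) := (r.isUnit.pow 2).mul (w' * w⁻¹).isUnit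
    rw [hc, map_zero] at hu
    exact not_isUnit_zero hu
  · refine ha.eq_of_aeval_eq (d := 2) (by norm_num) (isHomogeneous_compMap hq' κ i)
      ((hq.isHomogeneous i).C_mul c) ?_
    rw [hcomp, hc, map_mul, aeval_C]

end Uniqueness

end GoppaVeronese

open GoppaVeronese in
theorem mainTheorem8 {k : Type*} [Field k] [Infinite k]
    {A : Type*} [CommRing A] [Algebra k A] [Module.Finite k A]
    (a : Fin 3 → A) (ha : IsCompleteIntersection k 3 3 a) :
    (∃ b : Fin 6 → A, IsGaleTransform k a b) ∧
    ∀ b : Fin 6 → A, IsGaleTransform k a b →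
      IsProjPoint b ∧
      ∃ q : Fin 6 → MvPolynomial (Fin 3) k,
        IsVeroneseMap q ∧ SameProjPoint b (compPoint q a) ∧
        ∀ (a' : Fin 3 → A) (q' : Fin 6 → MvPolynomial (Fin 3) k),
          IsCompleteIntersection k 3 3 a' → IsVeroneseMap q' →
          SameProjPoint b (compPoint q' a') →
          ∃ κ : GL (Fin 3) k,
            SameProjPoint a' (compPoint (linearForms κ) a) ∧
            SameMap q (compMap q' (linearForms κ)) := by
  refine ⟨ha.exists_isGaleTransform, fun b hb => ⟨hb.isProjPoint ha, ?_⟩⟩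
  obtain ⟨q, hq, hbq⟩ := hb.exists_isVeroneseMap ha
  exact ⟨q, hq, hbq, fun a' q' ha' hq' hb' =>
    ha.exists_linearForms_of_sameProjPoint ha' hq hq' hbq hb'⟩
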